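/- Let $\mathbf{U}$ and $\mathbf{U}^+$ be (Grothendieck) universes with $\mathbf{U} \subseteq \mathbf{U}^+$, and let $\kappa$ be a regular cardinal in $\mathbf{U}$. We use the following terminology, for a universe $\mathbf{V}$ containing $\kappa$ (here $\mathbf{V} = \mathbf{U}$ or $\mathbf{V} = \mathbf{U}^+$). - An object $A$ of a locally $\mathbf{V}$-small category $\mathcal{A}$ is *$(\kappa,\mathbf{V})$-compact* if $\mathrm{Hom}_{\mathcal{A}}(A,-)$ preserves colimits of all $\mathbf{V}$-small $\kappa$-filtered diagrams. The full subcategory of such objects is denoted $\mathbf{K}_\kappa^{\mathbf{V}}(\mathcal{A})$. - A *$\kappa$-accessible $\mathbf{V}$-category* is a locally $\mathbf{V}$-small category $\mathcal{A}$ that has colimits of all $\mathbf{V}$-small $\kappa$-filtered diagrams and has a $\mathbf{V}$-small set $\mathcal{G}$ of $(\kappa,\mathbf{V})$-compact objects such that every object of $\mathcal{A}$ is the colimit of a $\mathbf{V}$-small $\kappa$-filtered diagram of objects in $\mathcal{G}$. - A *locally $\kappa$-presentable $\mathbf{V}$-category* is a $\kappa$-accessible $\mathbf{V}$-category that has colimits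 of all $\mathbf{V}$-small diagrams. - A *$(\kappa,\mathbf{U},\mathbf{U}^+)$-accessible extension* is a functor $i : \mathcal{C} \to \mathcal{C}^+$ such that $\mathcal{C}$ is a $\kappa$-accessible $\mathbf{U}$-category; $\mathcal{C}^+$ is a $\kappa$-accessible $\mathbf{U}^+$-category; $i$ preserves colimits of all $\mathbf{U}$-small $\kappa$-filtered diagrams; $i$ sends $(\kappa,\mathbf{U})$-compact objects to $(\kappa,\mathbf{U}^+)$-compact objects; and the induced functor $\mathbf{K}_\kappa^{\mathbf{U}}(\mathcal{C}) \to \mathbf{K}_\kappa^{\mathbf{U}^+}(\mathcal{C}^+)$ is fully faithful and essentially surjective on objects. **Proposition.** If $i : \mathcal{C} \to \mathcal{C}^+$ is a $(\kappa,\mathbf{U},\mathbf{U}^+)$-accessible extension and $\mathcal{C}$ is a locally $\kappa$-presentable $\mathbf{U}$-category, then $i$ preserves colimits of all $\mathbf{U}$-small diagrams in $\mathcal{C}$. -/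

import Mathlib

open CategoryTheory CategoryTheory.Limits

universe w w' v v' u u'

/-- A regular cardinal of the universe `Type w` is still regular in the larger universe
`Type (max w w')`. -/
instance fact_isRegular_lift (κ : Cardinal.{w}) [hκ : Fact κ.IsRegular] :
    Fact (Cardinal.lift.{w'} κ).IsRegular :=
  ⟨hκ.out.lift⟩

/-- The functor `K_κ(C) ⥤ K_κ'(D)` between full subcategories of compact (i.e. presentable)
objects induced by a functor `i : C ⥤ D` which sends `κ`-compact objects (relative to the universe
in which `κ` lives) to `κ'`-compact objects (relative to the universe in which `κ'` lives). -/
def compactRestriction {C : Type u} [Category.{v} C] {D : Type u'} [Category.{v'} D]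
    (i : C ⥤ D) (κ : Cardinal.{w}) [Fact κ.IsRegular] (κ' : Cardinal.{w'}) [Fact κ'.IsRegular]
    (h : ∀ X : C, isCardinalPresentable C κ X → isCardinalPresentable D κ' (i.obj X)) :
    (isCardinalPresentable C κ).FullSubcategory ⥤ (isCardinalPresentable D κ').FullSubcategory :=
  (isCardinalPresentable D κ').lift ((isCardinalPresentable C κ).ι ⋙ i)
    (fun X => h X.obj X.property)

/-- Accessible extensions. The universe `U` is `Type w`, the universe `U⁺ ⊇ U` is
`Type (max w w')`, and `κ` is a regular cardinal in `U`, which is regarded as the cardinal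
`Cardinal.lift κ` in `U⁺`. A functor `i : C ⥤ D` is a `(κ, U, U⁺)`-accessible extension if it is
`(κ, U)`-accessible, where `C` is a `κ`-accessible `U`-category, `D` is a `κ`-accessible
`U⁺`-category, `i` sends `(κ, U)`-compact objects to `(κ, U⁺)`-compact objects, and the
functor between the full subcategories of compact objects so induced by `i` is fully faithful
and essentially surjective. -/
structure IsAccessibleExtension {C : Type u} [Category.{v} C] {D : Type u'} [Category.{v'} D]
    (κ : Cardinal.{w}) [Fact κ.IsRegular] (i : C ⥤ D) : Prop where
  source_accessible : IsCardinalAccessibleCategory C κ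
  target_accessible : IsCardinalAccessibleCategory D (Cardinal.lift.{w'} κ)
  functor_accessible : i.IsCardinalAccessible κ
  map_compact : ∀ X : C, isCardinalPresentable C κ X →
    isCardinalPresentable D (Cardinal.lift.{w'} κ) (i.obj X)
  full : (compactRestriction i κ (Cardinal.lift.{w'} κ) map_compact).Full
  faithful : (compactRestriction i κ (Cardinal.lift.{w'} κ) map_compact).Faithful
  essSurj : (compactRestriction i κ (Cardinal.lift.{w'} κ) map_compact).EssSurj

/-! The arrows `i.obj A ⟶ Y` with `A` compact form a `κ`-filtered category, usually not U-small. A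
U-small family `i.obj (X t) ⟶ Y` involves only a U-small part of it, which a closure argument
enlarges to an essentially U-small `κ`-filtered part. Its colimit `Z` exists in `C` and is preserved
by `i`, so the family lifts to arrows `X t ⟶ Z` over one `i.obj Z ⟶ Y` (`exists_factorization`).
Existence and uniqueness of maps out of `i.obj (colim F)` thus reduce to the universal property of
`colim F` in `C`. -/

section CardinalFilteredClosure

variable {E : Type u} [Category.{v} E] (κ : Cardinal.{w}) [Fact κ.IsRegular]

/-- In a `κ`-filtered category, the diagrams of cardinality `< κ` in an essentially small full
subcategory admit cocones with points in another essentially small full subcategory. -/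
lemma exists_essentiallySmall_cocone_points [IsCardinalFiltered E κ] [LocallySmall.{w} E]
    (R : ObjectProperty E) [ObjectProperty.EssentiallySmall.{w} R] :
    ∃ R' : ObjectProperty E, ObjectProperty.EssentiallySmall.{w} R' ∧
      ∀ (A : Type w) [SmallCategory A] (F : A ⥤ E), (∀ a, R (F.obj a)) →
        HasCardinalLT (Arrow A) κ → ∃ c : Cocone F, R' c.pt := by
  let e := equivSmallModel.{w} R.FullSubcategory
  -- Up to equivalence there is only a U-small set of such diagrams; one cocone is chosen for each.
  let I : Type w := Σ S : SmallCategoryCardinalLT κ,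
    (SmallCategoryCardinalLT.categoryFamily κ S ⥤ SmallModel.{w} R.FullSubcategory)
  let G (x : I) :=
    IsCardinalFiltered.cocone (κ := κ) (x.2 ⋙ e.inverse ⋙ R.ι) x.1.hasCardinalLT
  let points : I → E := fun x => (G x).pt
  have : Small.{w} I := small_self.{w} I
  refine ⟨ObjectProperty.ofObj points, inferInstance, fun A _ F hF hA => ?_⟩
  obtain ⟨S, ⟨s⟩⟩ := SmallCategoryCardinalLT.exists_equivalence κ A hA
  let x : I := ⟨S, s.functor ⋙ R.lift F hF ⋙ e.functor⟩
  let iso : s.functor ⋙ F ≅ x.2 ⋙ e.inverse ⋙ R.ι :=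
    Functor.isoWhiskerLeft (s.functor ⋙ R.lift F hF) (Functor.isoWhiskerRight e.unitIso R.ι)
  exact ⟨(Cocone.equivalenceOfReindexing s (Iso.refl (s.functor ⋙ F))).inverse.obj
    ((Cocone.precompose iso.hom).obj (G x)), ⟨x⟩⟩

/-- In a `κ`-filtered category, any essentially small full subcategory is contained in
an essentially small full subcategory which is `κ`-filtered. -/
lemma exists_essentiallySmall_isCardinalFiltered [IsCardinalFiltered E κ] [LocallySmall.{w} E]
    (P : ObjectProperty E) [ObjectProperty.EssentiallySmall.{w} P] :
    ∃ Q : ObjectProperty E, P ≤ Q ∧ Q.IsClosedUnderIsomorphisms ∧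
      ObjectProperty.EssentiallySmall.{w} Q ∧ IsCardinalFiltered Q.FullSubcategory κ := by
  have : NoMaxOrder κ.ord.ToType :=
    Cardinal.noMaxOrder (Cardinal.IsRegular.aleph0_le Fact.out)
  choose next small_next exists_next using
    fun R : {R : ObjectProperty E // ObjectProperty.EssentiallySmall.{w} R} =>
      have := R.2
      exists_essentiallySmall_cocone_points κ R.1
  let step (α : κ.ord.ToType)
      (f : ∀ β, β < α → {R : ObjectProperty E // ObjectProperty.EssentiallySmall.{w} R}) :
      {R : ObjectProperty E // ObjectProperty.EssentiallySmall.{w} R} :=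
    -- Joining `P` at every stage avoids a case split into zero, successor and limit.
    ⟨P ⊔ ⨆ β : Set.Iio α, next (f β.1 β.2), inferInstance⟩
  let chain : κ.ord.ToType → {R : ObjectProperty E // ObjectProperty.EssentiallySmall.{w} R} :=
    WellFounded.fix wellFounded_lt step
  have chain_eq (α) : (chain α).1 = P ⊔ ⨆ β : Set.Iio α, next (chain β.1) := by
    dsimp only [chain]
    rw [WellFounded.fix_eq]
  have chain_mono {α β} (h : α ≤ β) : (chain α).1 ≤ (chain β).1 := by
    rw [chain_eq, chain_eq]
    exact sup_le_sup_left (iSup_le fun γ : Set.Iio α =>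
      le_iSup (fun δ : Set.Iio β => next (chain δ.1)) ⟨γ.1, lt_of_lt_of_le γ.2 h⟩) _
  have next_le {α β} (h : α < β) : next (chain α) ≤ (chain β).1 := by
    rw [chain_eq β]
    exact le_sup_of_le_right (le_iSup (fun δ : Set.Iio β => next (chain δ.1)) ⟨α, h⟩)
  have (α : κ.ord.ToType) := (chain α).2
  let Q : ObjectProperty E := ⨆ α, (chain α).1
  have small_Q : ObjectProperty.EssentiallySmall.{w} Q := inferInstance
  have hQ (X) : Q X ↔ ∃ α, (chain α).1 X := by simp [Q]
  have filtered : IsCardinalFiltered Q.FullSubcategory κ := ⟨fun {A} _ F hA => by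
    choose α hα using fun a => (hQ _).1 (F.obj a).property
    have hA' : HasCardinalLT A κ := hasCardinalLT_of_hasCardinalLT_arrow hA
    -- By regularity of `κ`, fewer than `κ` stages are bounded, so the diagram lies in a single
    -- stage.
    let β := IsCardinalFiltered.max α hA'
    obtain ⟨c, hc⟩ := exists_next (chain β) A (F ⋙ Q.ι)
      (fun a => chain_mono (leOfHom (IsCardinalFiltered.toMax α hA' a)) _ (hα a)) hA
    obtain ⟨γ, hγ⟩ := exists_gt β
    exact ⟨{
      pt := ⟨c.pt, (hQ _).2 ⟨γ, next_le hγ _ hc⟩⟩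
      ι := { app a := Q.fullyFaithfulι.preimage (c.ι.app a)
             naturality a b f := Q.ι.map_injective (by simpa using c.ι.naturality f) } }⟩⟩
  refine ⟨Q.isoClosure, fun X hX => Q.le_isoClosure _ ?_, inferInstance, inferInstance, ?_⟩
  · obtain ⟨α⟩ : Nonempty κ.ord.ToType := IsCardinalFiltered.nonempty _ κ
    exact (hQ X).2 ⟨α, by rw [chain_eq]; exact Or.inl hX⟩
  · have := (ObjectProperty.isEquivalence_ιOfLE_iff Q.le_isoClosure).2 le_rfl
    exact IsCardinalFiltered.of_equivalence κ
      (ObjectProperty.ιOfLE Q.le_isoClosure).asEquivalence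

end CardinalFilteredClosure

/-- The cocone which presents an object `X` as the canonical colimit of the `κ`-presentable objects
over `X`. -/
def presentableCocone {C : Type u} [Category.{v} C] (κ : Cardinal.{w}) [Fact κ.IsRegular] (X : C) :
    Cocone (CostructuredArrow.proj (isCardinalPresentable C κ).ι X ⋙
      (isCardinalPresentable C κ).ι) where
  pt := X
  ι := { app a := a.hom
         naturality _ _ f := (CostructuredArrow.w f).trans (Category.comp_id _).symm }

/-- In a `κ`-accessible category, the canonical cocone of `κ`-presentable objects over `X` is
colimiting. -/
noncomputable def isColimitPresentableCocone {C : Type u} [Category.{v} C] (κ : Cardinal.{w})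
    [Fact κ.IsRegular] [IsCardinalAccessibleCategory C κ] (X : C) :
    IsColimit (presentableCocone κ X) :=
  IsColimit.ofIsoColimit ((isCardinalPresentable C κ).ι.denseAt X)
    (Cocone.ext (Iso.refl _) fun a =>
      (Category.comp_id _).trans (Category.id_comp a.hom))

lemma isCardinalFiltered_of_lift {E : Type u} [Category.{v} E] (κ : Cardinal.{w})
    [Fact κ.IsRegular] [IsCardinalFiltered E (Cardinal.lift.{w'} κ)] :
    IsCardinalFiltered E κ where
  nonempty_cocone F hA :=
    ⟨IsCardinalFiltered.cocone (κ := Cardinal.lift.{w'} κ) F (by simpa using hA)⟩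

namespace IsAccessibleExtension

variable {C : Type u} [Category.{v} C] {D : Type u'} [Category.{v'} D]
  {κ : Cardinal.{w}} [Fact κ.IsRegular] {i : C ⥤ D}

/-- Equivalence on compact objects identifies this with the category of compact objects of `D` over
`Y`, which is filtered as `D` is accessible. -/
lemma isCardinalFiltered_costructuredArrow (hi : IsAccessibleExtension.{w, w'} κ i) (Y : D) :
    IsCardinalFiltered (CostructuredArrow ((isCardinalPresentable C κ).ι ⋙ i) Y) κ := by
  have := hi.target_accessible
  have := hi.full
  have := hi.faithful
  have := hi.essSurj
  let r := compactRestriction i κ (Cardinal.lift.{w'} κ) hi.map_compact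
  have : r.IsEquivalence := { }
  have := IsCardinalFiltered.of_equivalence (Cardinal.lift.{w'} κ)
    (CostructuredArrow.pre r (isCardinalPresentable D (Cardinal.lift.{w'} κ)).ι Y).asEquivalence.symm
  exact isCardinalFiltered_of_lift.{w, w'} (E := CostructuredArrow
    (r ⋙ (isCardinalPresentable D (Cardinal.lift.{w'} κ)).ι) Y) κ

/-- Any small family of morphisms `i.obj (X t) ⟶ Y` factors through a morphism `i.obj Z ⟶ Y`, in
such a way that the identities between these morphisms that hold after precomposition with
`κ`-presentable objects already hold over `Z`. -/
lemma exists_factorization (hi : IsAccessibleExtension.{w, w'} κ i) {T : Type w} (X : T → C)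
    {Y : D} (φ : ∀ t, i.obj (X t) ⟶ Y) :
    ∃ (Z : C) (π : i.obj Z ⟶ Y) (l : ∀ t, X t ⟶ Z), (∀ t, i.map (l t) ≫ π = φ t) ∧
      ∀ (s t : T) (A : C) (_ : isCardinalPresentable C κ A) (a : A ⟶ X s) (b : A ⟶ X t),
        i.map a ≫ φ s = i.map b ≫ φ t → a ≫ l s = b ≫ l t := by
  have := hi.source_accessible
  have := hi.functor_accessible
  have := hi.isCardinalFiltered_costructuredArrow Y
  let K := isCardinalPresentable C κ
  let M := SmallModel.{w} K.FullSubcategory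
  let e : K.FullSubcategory ≌ M := equivSmallModel.{w} K.FullSubcategory
  let obj {A : K.FullSubcategory} {t : T} (a : A.obj ⟶ X t) :
      CostructuredArrow (K.ι ⋙ i) Y := CostructuredArrow.mk (Y := A) (i.map a ≫ φ t)
  -- Representatives of compact objects and shrunken hom-sets keep the index U-small; closure of `Q`
  -- under isomorphisms recovers all compact `A`.
  let P : ObjectProperty (CostructuredArrow (K.ι ⋙ i) Y) :=
    .ofObj fun x : (Σ (t : T) (m : M), Shrink.{w} ((e.inverse.obj m).obj ⟶ X t)) =>
      obj ((equivShrink _).symm x.2.2)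
  obtain ⟨Q, hPQ, _, _, _⟩ := exists_essentiallySmall_isCardinalFiltered κ P
  have hQ {A : K.FullSubcategory} {t : T} (a : A.obj ⟶ X t) : Q (obj a) := by
    let a' : (e.inverse.obj (e.functor.obj A)).obj ⟶ X t := (e.unitIso.inv.app A).hom ≫ a
    refine Q.prop_of_iso (X := obj a') ?_ (hPQ _ ?_)
    · exact CostructuredArrow.isoMk (e.unitIso.app A).symm (by simp [obj, a'])
    · have := ObjectProperty.ofObj_apply (fun x : (Σ (t : T) (m : M),
        Shrink.{w} ((e.inverse.obj m).obj ⟶ X t)) => obj ((equivShrink _).symm x.2.2))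
        ⟨t, e.functor.obj A, equivShrink _ a'⟩
      simpa only [Equiv.symm_apply_apply] using this
  let p : Q.FullSubcategory ⥤ C := Q.ι ⋙ CostructuredArrow.proj _ _ ⋙ K.ι
  have : HasColimitsOfShape (SmallModel.{w} Q.FullSubcategory) C := by
    have := IsCardinalFiltered.of_equivalence κ (equivSmallModel.{w} Q.FullSubcategory)
    exact HasCardinalFilteredColimits.hasColimitsOfShape (κ := κ) C _
  have : HasColimitsOfShape Q.FullSubcategory C :=
    hasColimitsOfShape_of_equivalence (equivSmallModel.{w} Q.FullSubcategory).symm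
  have := i.preservesColimitsOfShape_of_isCardinalAccessible_of_essentiallySmall κ
    Q.FullSubcategory
  let c : Cocone (p ⋙ i) :=
    { pt := Y
      ι := { app q := q.obj.hom
             naturality q q' f := by
               exact (CostructuredArrow.w f.hom).trans (Category.comp_id _).symm } }
  let π : i.obj (colimit p) ⟶ Y := (isColimitOfPreserves i (colimit.isColimit p)).desc c
  have hπ (q) : i.map (colimit.ι p q) ≫ π = q.obj.hom :=
    (isColimitOfPreserves i (colimit.isColimit p)).fac c q
  let lc (t : T) : Cocone (CostructuredArrow.proj K.ι (X t) ⋙ K.ι) :=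
    { pt := colimit p
      ι := { app a := colimit.ι p ⟨obj a.hom, hQ a.hom⟩
             naturality a b f := by
               have w : (K.ι ⋙ i).map f.left ≫ (obj b.hom).hom = (obj a.hom).hom := by
                 have := CostructuredArrow.w f
                 simp [obj, ← this]
               let g : (⟨obj a.hom, hQ a.hom⟩ : Q.FullSubcategory) ⟶ ⟨obj b.hom, hQ b.hom⟩ :=
                 ObjectProperty.homMk (CostructuredArrow.homMk f.left w)
               exact (colimit.w p g).trans (Category.comp_id _).symm } }
  let l (t : T) : X t ⟶ colimit p := (isColimitPresentableCocone κ (X t)).desc (lc t)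
  have hl {A : K.FullSubcategory} {t : T} (a : A.obj ⟶ X t) :
      a ≫ l t = colimit.ι p ⟨obj a, hQ a⟩ :=
    (isColimitPresentableCocone κ (X t)).fac (lc t) (CostructuredArrow.mk (Y := A) a)
  refine ⟨colimit p, π, l, fun t => ?_, fun s t A hA a b hab => ?_⟩
  · have := i.preservesColimitsOfShape_of_isCardinalAccessible_of_essentiallySmall κ
      (CostructuredArrow K.ι (X t))
    refine (isColimitOfPreserves i (isColimitPresentableCocone κ (X t))).hom_ext fun a => ?_
    change i.map a.hom ≫ i.map (l t) ≫ π = i.map a.hom ≫ φ t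
    refine Eq.trans ?_ (hπ ⟨obj a.hom, hQ a.hom⟩)
    rw [← hl a.hom]
    exact (i.map_comp_assoc a.hom (l t) π).symm
  · let A' : K.FullSubcategory := ⟨A, hA⟩
    -- `a` and `b` enter `obj` only through their composites to `Y`, so they give the same object of
    -- `Q` and the same coprojection.
    have h : obj (A := A') a = obj (A := A') b := congrArg (CostructuredArrow.mk (Y := A')) hab
    refine (hl (A := A') a).trans (Eq.trans ?_ (hl (A := A') b).symm)
    congr 2

lemma hom_ext_of_isCardinalPresentable [IsCardinalAccessibleCategory C κ] {X Z : C} {f g : X ⟶ Z}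
    (h : ∀ (A : C) (_ : isCardinalPresentable C κ A) (a : A ⟶ X), a ≫ f = a ≫ g) : f = g :=
  (isColimitPresentableCocone κ X).hom_ext fun a => h a.left.obj a.left.property a.hom

lemma preservesColimit (hi : IsAccessibleExtension.{w, w'} κ i) {J : Type w} [SmallCategory J]
    (F : J ⥤ C) : PreservesColimit F i where
  preserves {c} hc := by
    have := hi.source_accessible
    have exists_desc (s : Cocone (F ⋙ i)) :
        ∃ m : i.obj c.pt ⟶ s.pt, ∀ j, i.map (c.ι.app j) ≫ m = s.ι.app j := by
      obtain ⟨Z, π, l, hl, h⟩ := hi.exists_factorization F.obj s.ι.app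
      let c' : Cocone F :=
        { pt := Z
          ι := { app := l
                 naturality j j' f := by
                   refine hom_ext_of_isCardinalPresentable (κ := κ) fun A hA a => ?_
                   have := h j' j A hA (a ≫ F.map f) a (by
                     rw [i.map_comp, Category.assoc]
                     exact congrArg _ (s.w f))
                   simpa using this } }
      refine ⟨i.map (hc.desc c') ≫ π, fun j => ?_⟩
      rw [← Category.assoc, ← i.map_comp, hc.fac]
      exact hl j
    have hom_ext {Y : D} (u v : i.obj c.pt ⟶ Y)
        (huv : ∀ j, i.map (c.ι.app j) ≫ u = i.map (c.ι.app j) ≫ v) : u = v := by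
      -- Treating `u` and `v` as one family lifts both over the same `π`, so it suffices to compare
      -- the lifts in `C`.
      obtain ⟨Z, π, l, hl, h⟩ := hi.exists_factorization (T := ULift Bool) (fun _ => c.pt)
        (fun t => bif t.down then u else v)
      have hl' : l ⟨true⟩ = l ⟨false⟩ := hc.hom_ext fun j =>
        hom_ext_of_isCardinalPresentable (κ := κ) fun A hA a => by
          have := h ⟨true⟩ ⟨false⟩ A hA (a ≫ c.ι.app j) (a ≫ c.ι.app j) (by simp [huv])
          simpa using this
      have hu : i.map (l ⟨true⟩) ≫ π = u := hl ⟨true⟩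
      have hv : i.map (l ⟨false⟩) ≫ π = v := hl ⟨false⟩
      rw [← hu, ← hv, hl']
    choose desc fac using exists_desc
    exact ⟨{
      desc := desc
      fac := fac
      uniq s m hm := hom_ext _ _ fun j => (hm j).trans (fac s j).symm }⟩

end IsAccessibleExtension

theorem mainTheorem3 {C : Type u} [Category.{v} C] {D : Type u'} [Category.{v'} D]
    (κ : Cardinal.{w}) [Fact κ.IsRegular] (i : C ⥤ D)
    (hi : IsAccessibleExtension.{w, w'} κ i) [IsCardinalLocallyPresentable C κ] :
    PreservesColimitsOfSize.{w, w} i where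
  preservesColimitsOfShape := ⟨fun {F} => hi.preservesColimit F⟩
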